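/- Let $k>1$ be an integer and let $\{a_n\}_{n=0}^{\infty}$ be a linear recurrence sequence of integers of order $k$, satisfying $$a_{n+k}=r_1a_{n+k-1}+\cdots+r_ka_n\qquad(n=0,1,2,\dots)$$ with $r_1,\dots,r_k\in\mathbb{Z}$ and $r_k\neq 0$; here the order is the minimal one, i.e. $k$ is the least positive integer for which $\{a_n\}$ satisfies a relation of this form. Suppose that the sequence is non-degenerate, i.e. that the characteristic polynomial $g(x)=1-\sum_{i=1}^{k}r_ix^i$ does not have two distinct complex roots whose ratio is a root of unity. Then $\{a_n\}_{n=0}^{\infty}$ has infinitely many prime divisors: there are infinitely many primes $p$ such that $p\mid a_n$ for some $n\ge 0$. -/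

import Mathlib

/-- `a` satisfies `a (n+k) = r 1 * a (n+k-1) + ⋯ + r k * a n` for all `n ≥ 0`.
Only the values `r 1, …, r k` matter; in each term `i ≤ k`, so the subtraction is exact. -/
def SatisfiesRecurrence (a : ℕ → ℤ) (k : ℕ) (r : ℕ → ℤ) : Prop :=
  ∀ n : ℕ, a (n + k) = ∑ i ∈ Finset.Icc 1 k, r i * a (n + k - i)

/-- `a` is a linear recurrence sequence of order exactly `k`: `k` is the least positive integer
for which `a` satisfies a recurrence of length `k` with integer coefficients and `r k ≠ 0`. -/
def HasRecurrenceOrder (a : ℕ → ℤ) (k : ℕ) : Prop :=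
  IsLeast {j : ℕ | 1 ≤ j ∧ ∃ r : ℕ → ℤ, r j ≠ 0 ∧ SatisfiesRecurrence a j r} k

/-- The characteristic polynomial `1 - ∑_{i=1}^k r_i x^i` of a recurrence relation. -/
noncomputable def recurrenceCharPoly (k : ℕ) (r : ℕ → ℤ) : Polynomial ℤ :=
  1 - ∑ i ∈ Finset.Icc 1 k, Polynomial.C (r i) * Polynomial.X ^ i

/-- No two distinct complex roots of the characteristic polynomial have a ratio that is a root
of unity. (The roots are nonzero, since the constant coefficient is `1`.) -/
def NonDegenerate (k : ℕ) (r : ℕ → ℤ) : Prop :=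
  ∀ x y : ℂ, Polynomial.aeval x (recurrenceCharPoly k r) = 0 →
    Polynomial.aeval y (recurrenceCharPoly k r) = 0 → x ≠ y →
      ∀ m : ℕ, 0 < m → (x / y) ^ m ≠ 1

/-- The set of prime divisors of a sequence: the primes dividing at least one term. -/
def primeDivisors (a : ℕ → ℤ) : Set ℕ :=
  {p : ℕ | p.Prime ∧ ∃ n : ℕ, (p : ℤ) ∣ a n}

/-! Suppose only finitely many primes divide terms of the sequence, and let `q` be an odd prime that
divides none. For any prime `p`, a suitable progression makes the terms p-adically geometric up to
relative error less than one. Doing this for all the prime divisors and for `q` gives one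
subsequence `b`. The quotient `b (s+2) * b s / b (s+1)^2` is then p-adically close to 1 at each of
these primes and a unit at every other prime, so it is 1 or -1, and closeness at `q` excludes -1.
Hence `b` is geometric, which `NonDegenerate.not_geometric` forbids.

The p-adic approximation (`exists_padicGeometric_subprogression`) divides by powers of some `c` in
`ℚ_[p]` with the norm of a power of a largest characteristic root. The new roots have norm at most
one, so the rescaled sequence is bounded, and compactness of balls in `ℚ_[p]` makes it almost
periodic. It does not tend to zero: by `NonDegenerate.isolate_root`, a fixed linear combination of
its shifts has constant nonzero norm. An almost period starting at a term that is not small gives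
the geometric approximation. -/

open Polynomial

/-! ### Sequences as a module over polynomials in the shift -/

/-- The left shift operator on sequences. -/
def seqShift (R : Type*) [CommRing R] : Module.End R (ℕ → R) :=
  LinearMap.funLeft R R Nat.succ

section Shift
variable {R S : Type*} [CommRing R] [CommRing S]

@[simp] lemma seqShift_apply (a : ℕ → R) (n : ℕ) : seqShift R a n = a (n + 1) := rfl

lemma seqShift_pow_apply (i : ℕ) (a : ℕ → R) (n : ℕ) : (seqShift R ^ i) a n = a (n + i) := by
  induction i generalizing n with
  | zero => simp
  | succ i ih => rw [pow_succ', Module.End.mul_apply, seqShift_apply, ih]; congr 1; ring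

lemma aeval_seqShift_apply (P : R[X]) (a : ℕ → R) (n : ℕ) :
    aeval (seqShift R) P a n = ∑ i ∈ Finset.range (P.natDegree + 1), P.coeff i * a (n + i) := by
  rw [aeval_eq_sum_range]
  simp [LinearMap.sum_apply, Finset.sum_apply, seqShift_pow_apply]

lemma aeval_seqShift_map (φ : R →+* S) (P : R[X]) (a : ℕ → R) (n : ℕ) :
    aeval (seqShift S) (P.map φ) (fun m => φ (a m)) n = φ (aeval (seqShift R) P a n) := by
  induction P using Polynomial.induction_on' with
  | add p q hp hq => simp [hp, hq]
  | monomial i c => simp [aeval_monomial, seqShift_pow_apply, Module.algebraMap_end_apply]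

lemma aeval_seqShift_comp_add (P : R[X]) (a : ℕ → R) (N n : ℕ) :
    aeval (seqShift R) P (fun m => a (N + m)) n = aeval (seqShift R) P a (N + n) := by
  simp only [aeval_seqShift_apply, add_assoc]

lemma aeval_seqShift_of_dvd {P Q : R[X]} (h : P ∣ Q) {a : ℕ → R}
    (ha : aeval (seqShift R) P a = 0) : aeval (seqShift R) Q a = 0 := by
  obtain ⟨T, rfl⟩ := h
  rw [mul_comm, map_mul, Module.End.mul_apply, ha, map_zero]

lemma aeval_seqShift_X_sub_C (c : R) (a : ℕ → R) (n : ℕ) :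
    aeval (seqShift R) (X - C c) a n = a (n + 1) - c * a n := by
  simp [Module.algebraMap_end_apply]

lemma aeval_seqShift_X_pow_sub_C (T : ℕ) (c : R) (a : ℕ → R) (n : ℕ) :
    aeval (seqShift R) (X ^ T - C c) a n = a (n + T) - c * a n := by
  simp [Module.algebraMap_end_apply, seqShift_pow_apply]

lemma eq_mul_pow_of_aeval_X_sub_C {c : R} {a : ℕ → R}
    (ha : aeval (seqShift R) (X - C c) a = 0) (n : ℕ) : a n = a 0 * c ^ n := by
  induction n with
  | zero => simp
  | succ n ih =>
    have h := aeval_seqShift_X_sub_C c a n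
    rw [ha, Pi.zero_apply] at h
    rw [sub_eq_zero.1 h.symm, ih]
    ring

end Shift

/-- Subsequence along a progression, rescaled by a geometric factor. -/
lemma aeval_seqShift_progression {K : Type*} [Field K] (N R : ℕ) {c : K} (hc : c ≠ 0)
    (s : Multiset K) (a : ℕ → K) (m : ℕ) :
    aeval (seqShift K) (s.map fun γ => X - C (γ / c)).prod (fun m => a (N + R * m) / c ^ m) m =
      (aeval (seqShift K) (s.map fun γ => X ^ R - C γ).prod a (N + R * m)) /
        c ^ (m + Multiset.card s) := by
  induction s using Multiset.induction_on generalizing m with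
  | empty => simp
  | cons γ s ih =>
    simp only [Multiset.map_cons, Multiset.prod_cons, map_mul, Module.End.mul_apply,
      Multiset.card_cons]
    -- Each linear factor brings the terms at `m + 1` and `m` to a common denominator and so costs
    -- one more power of `c`; hence the exponent `m + card s`.
    rw [aeval_seqShift_X_sub_C, aeval_seqShift_X_pow_sub_C, ih, ih]
    rw [show N + R * (m + 1) = N + R * m + R by ring,
      show m + 1 + s.card = m + s.card + 1 by ring, ← add_assoc, pow_succ]
    field_simp

/-- A relation whose characteristic roots are bounded by one does not increase the norm. -/
lemma norm_le_of_aeval_prod_eq_zero {K : Type*} [NormedField K] [IsUltrametricDist K]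
    (s : Multiset K) (hs : ∀ β ∈ s, ‖β‖ ≤ 1) (v : ℕ → K) (ε : ℝ) (hε : 0 ≤ ε)
    (hv : aeval (seqShift K) (s.map fun β => X - C β).prod v = 0)
    (hi : ∀ i < Multiset.card s, ‖v i‖ ≤ ε) (n : ℕ) : ‖v n‖ ≤ ε := by
  induction s using Multiset.induction_on generalizing v n with
  | empty =>
    have : v = 0 := by simpa using hv
    simp [this, hε]
  | cons β s ih =>
    have hβ : ‖β‖ ≤ 1 := hs β (Multiset.mem_cons_self _ _)
    have key : ∀ x y : K, ‖x‖ ≤ ε → ‖y‖ ≤ ε → ‖x - β * y‖ ≤ ε ∧ ‖x + β * y‖ ≤ ε := by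
      intro x y hx hy
      have h : ‖β * y‖ ≤ ε := by
        rw [norm_mul]; exact (mul_le_of_le_one_left (norm_nonneg _) hβ).trans hy
      refine ⟨?_, (IsUltrametricDist.norm_add_le_max _ _).trans (max_le hx h)⟩
      rw [sub_eq_add_neg]
      exact (IsUltrametricDist.norm_add_le_max _ _).trans (max_le hx (by rwa [norm_neg]))
    -- Applying `X - β` shortens the relation, so the result `w` is bounded by induction; then `v
    -- (n+1) = w n + β * v n` propagates the bound.
    have hw := ih (fun γ hγ => hs γ (Multiset.mem_cons_of_mem hγ))
      (aeval (seqShift K) (X - C β) v) (by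
        rw [Multiset.map_cons, Multiset.prod_cons, mul_comm, map_mul, Module.End.mul_apply] at hv
        exact hv) (fun i hi' => by
        rw [aeval_seqShift_X_sub_C]
        exact (key _ _ (hi _ (by simpa using hi')) (hi _ (by simp; omega))).1)
    induction n with
    | zero => exact hi 0 (by simp)
    | succ n ihn =>
      have h := hw n
      have h2 := aeval_seqShift_X_sub_C β v n
      rw [h2] at h
      simpa using (key _ _ h ihn).2

/-! ### The characteristic polynomial and non-degeneracy -/

/-- The monic characteristic polynomial `X ^ k - r₁ X ^ (k - 1) - ⋯ - r_k`. -/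
noncomputable def monicCharPoly (k : ℕ) (r : ℕ → ℤ) : ℤ[X] :=
  X ^ k - ∑ i ∈ Finset.Icc 1 k, C (r i) * X ^ (k - i)

lemma degree_monicCharPoly_tail (k : ℕ) (r : ℕ → ℤ) :
    (∑ i ∈ Finset.Icc 1 k, C (r i) * X ^ (k - i)).degree < (k : WithBot ℕ) := by
  refine (degree_sum_le _ _).trans_lt ((Finset.sup_lt_iff (WithBot.bot_lt_coe k)).2 fun i hi => ?_)
  rw [Finset.mem_Icc] at hi
  refine (degree_C_mul_X_pow_le _ _).trans_lt ?_
  exact Nat.cast_lt.2 (by omega)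

lemma monic_monicCharPoly (k : ℕ) (r : ℕ → ℤ) : (monicCharPoly k r).Monic :=
  monic_X_pow_sub (degree_monicCharPoly_tail k r)

lemma natDegree_monicCharPoly (k : ℕ) (r : ℕ → ℤ) : (monicCharPoly k r).natDegree = k := by
  apply natDegree_eq_of_degree_eq_some
  rw [monicCharPoly, degree_sub_eq_left_of_degree_lt] <;> rw [degree_X_pow]
  exact degree_monicCharPoly_tail k r

lemma coeff_zero_monicCharPoly {k : ℕ} (hk : 1 ≤ k) (r : ℕ → ℤ) :
    (monicCharPoly k r).coeff 0 = - r k := by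
  have h : ∀ i ∈ Finset.Icc 1 k, i ≠ k → (C (r i) * X ^ (k - i)).coeff 0 = 0 := by
    intro i hi hik
    rw [Finset.mem_Icc] at hi
    rw [coeff_C_mul, coeff_X_pow, if_neg (by omega), mul_zero]
  rw [monicCharPoly, coeff_sub, finsetSum_coeff, Finset.sum_eq_single_of_mem k (by simp [hk]) h,
    coeff_X_pow]
  simp [show (0 : ℕ) ≠ k by omega]

lemma aeval_seqShift_monicCharPoly {a : ℕ → ℤ} {k : ℕ} {r : ℕ → ℤ}
    (h : SatisfiesRecurrence a k r) : aeval (seqShift ℤ) (monicCharPoly k r) a = 0 := by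
  funext n
  simp only [monicCharPoly, map_sub, map_pow, aeval_X, map_sum, map_mul, aeval_C,
    LinearMap.sub_apply, LinearMap.sum_apply, Module.End.mul_apply, Pi.sub_apply, Finset.sum_apply,
    Module.algebraMap_end_apply, Pi.smul_apply, seqShift_pow_apply, smul_eq_mul, Pi.zero_apply]
  rw [h n, sub_eq_zero]
  refine Finset.sum_congr rfl fun i hi => ?_
  rw [Finset.mem_Icc] at hi
  rw [Nat.add_sub_assoc hi.2]

lemma satisfiesRecurrence_of_aeval {a : ℕ → ℤ} {f : ℤ[X]} (hf : f.Monic)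
    (h : aeval (seqShift ℤ) f a = 0) :
    SatisfiesRecurrence a f.natDegree (fun i => - f.coeff (f.natDegree - i)) := by
  intro n
  have h1 := aeval_seqShift_apply f a n
  rw [h, Pi.zero_apply, Finset.sum_range_succ, hf.coeff_natDegree, one_mul] at h1
  rw [← Finset.sum_range_reflect] at h1
  rw [eq_neg_of_add_eq_zero_right h1.symm, ← Finset.sum_neg_distrib,
    Finset.sum_bij (fun i _ => i + 1)]
  · intro i hi
    simp only [Finset.mem_range, Finset.mem_Icc] at *
    omega
  · intro i _ j _ hij
    omega
  · intro i hi
    simp only [Finset.mem_range, Finset.mem_Icc] at *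
    exact ⟨i - 1, by omega, by omega⟩
  · intro i hi
    rw [Finset.mem_range] at hi
    rw [show f.natDegree - 1 - i = f.natDegree - (i + 1) by omega,
      show n + (f.natDegree - (i + 1)) = n + f.natDegree - (i + 1) by omega]
    ring

/-- The two characteristic polynomials are reciprocal to each other. Inversion preserves whether a
ratio is a root of unity, so non-degeneracy can be read on the monic one. -/
lemma aeval_recurrenceCharPoly_inv {k : ℕ} {r : ℕ → ℤ} {x : ℂ} (hx : x ≠ 0)
    (h : aeval x (monicCharPoly k r) = 0) : aeval x⁻¹ (recurrenceCharPoly k r) = 0 := by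
  have key : x ^ k * aeval x⁻¹ (recurrenceCharPoly k r) = aeval x (monicCharPoly k r) := by
    simp only [recurrenceCharPoly, monicCharPoly, map_sub, map_one, map_sum, map_mul, map_pow,
      aeval_X, mul_sub, mul_one, Finset.mul_sum, aeval_C]
    congr 1
    refine Finset.sum_congr rfl fun i hi => ?_
    rw [Finset.mem_Icc] at hi
    rw [pow_sub₀ _ hx hi.2, inv_pow]
    ring
  rw [h] at key
  exact (mul_eq_zero.1 key).resolve_left (pow_ne_zero _ hx)

lemma ne_zero_of_aeval_monicCharPoly {K : Type*} [Field K] [CharZero K] {k : ℕ} (hk : 1 ≤ k)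
    {r : ℕ → ℤ} (hr : r k ≠ 0) {x : K} (hx : aeval x (monicCharPoly k r) = 0) : x ≠ 0 := by
  rintro rfl
  rw [← coeff_zero_eq_aeval_zero', coeff_zero_monicCharPoly hk] at hx
  simp [hr] at hx

lemma NonDegenerate.pow_ne_pow {k : ℕ} (hk : 1 ≤ k) {r : ℕ → ℤ} (hr : r k ≠ 0)
    (hnd : NonDegenerate k r) {x y : ℂ} (hx : aeval x (monicCharPoly k r) = 0)
    (hy : aeval y (monicCharPoly k r) = 0) (hxy : x ≠ y) {m : ℕ} (hm : 0 < m) :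
    x ^ m ≠ y ^ m := by
  have hx0 := ne_zero_of_aeval_monicCharPoly hk hr hx
  have hy0 := ne_zero_of_aeval_monicCharPoly hk hr hy
  intro h
  refine hnd x⁻¹ y⁻¹ (aeval_recurrenceCharPoly_inv hx0 hx) (aeval_recurrenceCharPoly_inv hy0 hy)
    (by simpa using hxy) m hm ?_
  rw [div_pow, inv_pow, inv_pow, h, div_self]
  exact inv_ne_zero (pow_ne_zero _ hy0)

/-- A root of an integer polynomial in a field of characteristic zero comes from `ℚ̄`. -/
lemma exists_algebraicClosure_root {L : Type*} [Field L] [CharZero L] {f : ℤ[X]} (hf : f.Monic)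
    (φ : AlgebraicClosure ℚ →+* L) {x : L} (hx : aeval x f = 0) :
    ∃ z : AlgebraicClosure ℚ, φ z = x ∧ aeval z f = 0 := by
  have hs := IsAlgClosed.splits (f.map (Int.castRingHom (AlgebraicClosure ℚ)))
  have hr := hs.roots_map φ
  rw [Polynomial.map_map, RingHom.ext_int (φ.comp (Int.castRingHom _)) (Int.castRingHom L)] at hr
  have hxr : x ∈ (f.map (Int.castRingHom L)).roots := by
    rw [mem_roots (hf.map _).ne_zero, IsRoot, eval_map]
    exact hx
  rw [hr, Multiset.mem_map] at hxr
  obtain ⟨z, hz, rfl⟩ := hxr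
  rw [mem_roots (hf.map _).ne_zero, IsRoot, eval_map] at hz
  exact ⟨z, rfl, hz⟩

/-- Non-degeneracy transfers to every algebraically closed field of characteristic zero. -/
lemma NonDegenerate.pow_ne_pow' {L : Type*} [Field L] [CharZero L] [IsAlgClosed L]
    {k : ℕ} (hk : 1 ≤ k) {r : ℕ → ℤ} (hr : r k ≠ 0)
    (hnd : NonDegenerate k r) {x y : L} (hx : aeval x (monicCharPoly k r) = 0)
    (hy : aeval y (monicCharPoly k r) = 0) (hxy : x ≠ y) {m : ℕ} (hm : 0 < m) :
    x ^ m ≠ y ^ m := by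
  have : Algebra.IsAlgebraic ℚ (AlgebraicClosure ℚ) := by
    convert! AlgebraicClosure.isAlgebraic ℚ
  let φ : AlgebraicClosure ℚ →+* L := (IsAlgClosed.lift : AlgebraicClosure ℚ →ₐ[ℚ] L).toRingHom
  let ψ : AlgebraicClosure ℚ →+* ℂ := (IsAlgClosed.lift : AlgebraicClosure ℚ →ₐ[ℚ] ℂ).toRingHom
  obtain ⟨z, rfl, hz⟩ := exists_algebraicClosure_root (monic_monicCharPoly k r) φ hx
  obtain ⟨w, rfl, hw⟩ := exists_algebraicClosure_root (monic_monicCharPoly k r) φ hy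
  have hψ : ∀ u : AlgebraicClosure ℚ, aeval u (monicCharPoly k r) = 0 →
      aeval (ψ u) (monicCharPoly k r) = 0 := fun u hu => by
    rw [← RingHom.toIntAlgHom_apply ψ, aeval_algHom_apply, hu, map_zero]
  have := hnd.pow_ne_pow hk hr (hψ z hz) (hψ w hw)
    (fun h => hxy (congrArg φ (ψ.injective h))) hm
  intro h
  rw [← map_pow, ← map_pow] at h this
  exact this (congrArg ψ (φ.injective h))

/-! ### Annihilators of a sequence of minimal order -/

/-- The characteristic polynomial of a minimal relation generates the annihilator over `ℚ`. -/
lemma HasRecurrenceOrder.dvd_rat {a : ℕ → ℤ} {k : ℕ} (hk : 1 < k) (horder : HasRecurrenceOrder a k)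
    {r : ℕ → ℤ} (hr : r k ≠ 0) (hrec : SatisfiesRecurrence a k r) {Q : ℚ[X]}
    (hQ : aeval (seqShift ℚ) Q (fun n => (a n : ℚ)) = 0) :
    (monicCharPoly k r).map (Int.castRingHom ℚ) ∣ Q := by
  classical
  set F := monicCharPoly k r
  set A : ℕ → ℚ := fun n => (a n : ℚ)
  have hFm : F.Monic := monic_monicCharPoly k r
  have hcast : ∀ f : ℤ[X], aeval (seqShift ℚ) (f.map (Int.castRingHom ℚ)) A = 0 ↔
      aeval (seqShift ℤ) f a = 0 := by
    intro f
    have := aeval_seqShift_map (Int.castRingHom ℚ) f a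
    simp only [eq_intCast] at this
    simp only [funext_iff, A, this, Pi.zero_apply, Int.cast_eq_zero]
  have hF : aeval (seqShift ℚ) (F.map (Int.castRingHom ℚ)) A = 0 :=
    (hcast F).2 (aeval_seqShift_monicCharPoly hrec)
  set h := EuclideanDomain.gcd (F.map (Int.castRingHom ℚ)) Q
  have hhA : aeval (seqShift ℚ) h A = 0 := by
    rw [show h = _ from EuclideanDomain.gcd_eq_gcd_ab _ _, map_add, LinearMap.add_apply,
      aeval_seqShift_of_dvd (Dvd.intro _ rfl) hF, aeval_seqShift_of_dvd (Dvd.intro _ rfl) hQ,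
      add_zero]
  have hhF : h ∣ F.map (Int.castRingHom ℚ) := EuclideanDomain.gcd_dvd_left _ _
  have hh0 : h ≠ 0 := ne_zero_of_dvd_ne_zero (hFm.map _).ne_zero hhF
  -- Gauss's lemma: up to a constant, the gcd is an integral monic polynomial, so minimality among
  -- integer relations applies to it.
  obtain ⟨g, hg⟩ := IsIntegrallyClosed.eq_map_mul_C_of_dvd ℚ hFm hhF
  have hl : h.leadingCoeff ≠ 0 := leadingCoeff_ne_zero.2 hh0
  have hinj : Function.Injective (Int.castRingHom ℚ) := Int.cast_injective
  change g.map (Int.castRingHom ℚ) * _ = _ at hg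
  have hgm : g.Monic := by
    apply monic_of_injective hinj
    have := congrArg leadingCoeff hg
    rw [leadingCoeff_mul, leadingCoeff_C] at this
    exact mul_right_cancel₀ hl (by rw [this, one_mul])
  have hga : aeval (seqShift ℤ) g a = 0 := by
    rw [← hcast]
    refine aeval_seqShift_of_dvd ⟨C h.leadingCoeff⁻¹, ?_⟩ hhA
    rw [eq_comm, ← mul_one (g.map _), ← C_1, ← mul_inv_cancel₀ hl, C_mul, ← mul_assoc, hg]
  have hgF : g ∣ F := by
    rw [← map_dvd_map _ hinj hgm]
    exact (Dvd.intro _ hg).trans hhF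
  have hkg : k ≤ g.natDegree := by
    rcases Nat.eq_zero_or_pos g.natDegree with h0 | hpos
    · have hg1 : g = 1 := eq_one_of_monic_natDegree_zero hgm h0
      -- The zero sequence satisfies a relation of length 1, contradicting `1 < k`.
      have ha0 : a = 0 := by simpa [hg1] using hga
      have := horder.2 (show 1 ∈ _ from ⟨le_rfl, fun _ => 1, one_ne_zero, fun n => by simp [ha0]⟩)
      omega
    · refine horder.2 ⟨hpos, _, ?_, satisfiesRecurrence_of_aeval hgm hga⟩
      -- The last coefficient of the relation given by `g` is nonzero because `g(0)` divides `F(0) =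
      -- -r k`.
      obtain ⟨t, ht⟩ := hgF
      have := congrArg (coeff · 0) ht
      simp only [mul_coeff_zero, F, coeff_zero_monicCharPoly hk.le] at this
      simp only [Nat.sub_self, ne_eq, neg_eq_zero]
      intro h0
      rw [h0, zero_mul, neg_eq_zero] at this
      exact hr this
  have hgF' : g = F := (eq_of_monic_of_dvd_of_natDegree_le hgm hFm hgF
    (by rw [natDegree_monicCharPoly]; exact hkg)).symm
  rw [← hgF']
  exact (Dvd.intro _ hg).trans (EuclideanDomain.gcd_dvd_right _ _)

/-- The annihilator does not grow under extension of the base field `ℚ`. -/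
lemma HasRecurrenceOrder.dvd {L : Type*} [Field L] [CharZero L] {a : ℕ → ℤ} {k : ℕ} (hk : 1 < k)
    (horder : HasRecurrenceOrder a k)
    {r : ℕ → ℤ} (hr : r k ≠ 0) (hrec : SatisfiesRecurrence a k r) {Q : L[X]}
    (hQ : aeval (seqShift L) Q (fun n => (a n : L)) = 0) :
    (monicCharPoly k r).map (Int.castRingHom L) ∣ Q := by
  set F := monicCharPoly k r with hFdef
  have hFm : F.Monic := monic_monicCharPoly k r
  have hF : aeval (seqShift L) (F.map (Int.castRingHom L)) (fun n => (a n : L)) = 0 := by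
    funext n
    have := aeval_seqShift_map (Int.castRingHom L) F a n
    rw [aeval_seqShift_monicCharPoly hrec] at this
    simpa using this
  rw [← modByMonic_eq_zero_iff_dvd (hFm.map _)]
  set M := Q %ₘ F.map (Int.castRingHom L) with hM
  have hMa : aeval (seqShift L) M (fun n => (a n : L)) = 0 := by
    rw [hM, modByMonic_eq_sub_mul_div, map_sub, LinearMap.sub_apply, hQ,
      aeval_seqShift_of_dvd (Dvd.intro _ rfl) hF, sub_zero]
  have hMd : M.degree < (k : WithBot ℕ) := by
    refine (degree_modByMonic_lt Q (hFm.map _)).trans_le ?_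
    rw [hFm.degree_map, degree_eq_natDegree hFm.ne_zero, natDegree_monicCharPoly]
  ext i
  rw [coeff_zero, ← Module.forall_dual_apply_eq_zero_iff ℚ]
  -- A `ℚ`-linear functional applied to the coefficients of `M` gives a rational annihilator, since
  -- the terms of `a` are rational. Its degree is below `k`, so it vanishes; functionals separate
  -- points of `L`.
  intro φ
  set q : ℚ[X] := ∑ j ∈ Finset.range (M.natDegree + 1), monomial j (φ (M.coeff j)) with hq
  have hqc : ∀ j, q.coeff j = φ (M.coeff j) := by
    intro j
    simp only [hq, finsetSum_coeff, coeff_monomial, Finset.sum_ite_eq', Finset.mem_range]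
    split_ifs with hj
    · rfl
    · rw [coeff_eq_zero_of_natDegree_lt (by omega), map_zero]
  have hqa : aeval (seqShift ℚ) q (fun n => (a n : ℚ)) = 0 := by
    funext n
    have h1 := congrArg φ (congrFun hMa n)
    rw [aeval_seqShift_apply, Pi.zero_apply, map_zero, map_sum] at h1
    rw [hq]
    simp only [map_sum, LinearMap.sum_apply, Finset.sum_apply, aeval_monomial,
      Module.End.mul_apply, Module.algebraMap_end_apply, Pi.smul_apply, seqShift_pow_apply,
      smul_eq_mul, Pi.zero_apply]
    rw [← h1]
    refine Finset.sum_congr rfl fun j _ => ?_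
    rw [mul_comm (M.coeff j), ← zsmul_eq_mul, map_zsmul, zsmul_eq_mul, mul_comm]
  have hdvd := horder.dvd_rat hk hr hrec hqa
  have hq0 : q = 0 := by
    refine eq_zero_of_dvd_of_degree_lt hdvd ?_
    rw [hFm.degree_map, degree_eq_natDegree hFm.ne_zero, natDegree_monicCharPoly,
      degree_lt_iff_coeff_zero]
    intro j hj
    rw [hqc, coeff_eq_zero_of_degree_lt (hMd.trans_le (by exact_mod_cast hj)), map_zero]
  rw [← hqc, hq0, coeff_zero]

/-! ### Isolating one characteristic root -/

lemma prod_X_sub_C_dvd_prod_X_pow_sub_C {K : Type*} [Field K] (R : ℕ) (s : Multiset K) :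
    (s.map fun γ => X - C γ).prod ∣ (s.map fun γ => X ^ R - C (γ ^ R)).prod := by
  refine Multiset.prod_dvd_prod_of_dvd _ _ fun γ _ => ?_
  rw [C_pow]
  exact sub_dvd_pow_sub_pow _ _ _

/-- Omitting one factor `X ^ R - α ^ R` destroys divisibility by the characteristic polynomial. -/
lemma not_prod_X_sub_C_dvd {K : Type*} [Field K] [CharZero K] {R : ℕ} (hR : 0 < R) {α : K}
    (hα : α ≠ 0) (s : Multiset K) (hs : ∀ γ ∈ s, γ ≠ α → γ ^ R ≠ α ^ R) :
    ¬ ((α ::ₘ s).map fun γ => X - C γ).prod ∣ (s.map fun γ => X ^ R - C (γ ^ R)).prod := by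
  intro h
  have hG : (s.map fun γ => X ^ R - C (γ ^ R)).prod =
      (s.map fun γ => ∑ i ∈ Finset.range R, X ^ i * C γ ^ (R - 1 - i)).prod *
        (s.map fun γ => X - C γ).prod := by
    rw [← Multiset.prod_map_mul]
    congr 1
    refine Multiset.map_congr rfl fun γ _ => ?_
    rw [(Commute.all _ _).geom_sum₂_mul, C_pow]
  rw [Multiset.map_cons, Multiset.prod_cons, hG] at h
  have h0 : (s.map fun γ => X - C γ).prod ≠ 0 :=
    (monic_multiset_prod_of_monic _ _ fun γ _ => monic_X_sub_C γ).ne_zero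
  -- After cancellation some geometric sum `∑ X^i γ^(R-1-i)` vanishes at `α`. For `γ = α` its value
  -- is `R α^(R-1)`, nonzero in characteristic zero, so repeated roots cause no trouble; otherwise
  -- `γ^R = α^R`.
  have h1 := dvd_iff_isRoot.1 ((mul_dvd_mul_iff_right h0).1 h)
  rw [IsRoot, eval_multiset_prod, Multiset.map_map, Multiset.prod_eq_zero_iff,
    Multiset.mem_map] at h1
  obtain ⟨γ, hγ, h2⟩ := h1
  simp only [Function.comp_apply, eval_finsetSum, eval_mul, eval_pow, eval_X, eval_C] at h2
  by_cases hγα : γ = α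
  · subst hγα
    rw [geom_sum₂_self] at h2
    exact mul_ne_zero (Nat.cast_ne_zero.2 hR.ne') (pow_ne_zero _ hα) h2
  · have := (Commute.all α γ).geom_sum₂_mul R
    rw [h2, zero_mul] at this
    exact hs γ hγ hγα (sub_eq_zero.1 this.symm).symm

lemma aeval_seqShift_monicCharPoly_map {K : Type*} [CommRing K] {a : ℕ → ℤ} {k : ℕ} {r : ℕ → ℤ}
    (hrec : SatisfiesRecurrence a k r) :
    aeval (seqShift K) ((monicCharPoly k r).map (Int.castRingHom K)) (fun n => (a n : K)) = 0 := by
  funext n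
  have := aeval_seqShift_map (Int.castRingHom K) (monicCharPoly k r) a n
  rw [aeval_seqShift_monicCharPoly hrec] at this
  simpa using this

lemma monicCharPoly_map_eq_prod (K : Type*) [Field K] [IsAlgClosed K] (k : ℕ) (r : ℕ → ℤ) :
    (monicCharPoly k r).map (Int.castRingHom K) =
      (((monicCharPoly k r).map (Int.castRingHom K)).roots.map fun γ => X - C γ).prod :=
  (IsAlgClosed.splits _).eq_prod_roots_of_monic ((monic_monicCharPoly k r).map _)

lemma card_roots_monicCharPoly_map (K : Type*) [Field K] [IsAlgClosed K] (k : ℕ) (r : ℕ → ℤ) :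
    Multiset.card ((monicCharPoly k r).map (Int.castRingHom K)).roots = k := by
  rw [← (IsAlgClosed.splits _).natDegree_eq_card_roots, (monic_monicCharPoly k r).natDegree_map,
    natDegree_monicCharPoly]

lemma aeval_eq_zero_of_mem_roots_monicCharPoly_map {K : Type*} [Field K] {k : ℕ} {r : ℕ → ℤ}
    {x : K} (hx : x ∈ ((monicCharPoly k r).map (Int.castRingHom K)).roots) :
    aeval x (monicCharPoly k r) = 0 := by
  rw [mem_roots ((monic_monicCharPoly k r).map _).ne_zero, IsRoot, eval_map] at hx
  exact hx

/-- Applying `X ^ T - γ ^ T` for all characteristic roots `γ` except one copy of `α` turns a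
non-degenerate recurrence sequence into a nonzero multiple of `α ^ n`. -/
lemma NonDegenerate.isolate_root {K : Type*} [Field K] [CharZero K] [IsAlgClosed K]
    {a : ℕ → ℤ} {k : ℕ} (hk : 1 < k) (horder : HasRecurrenceOrder a k)
    {r : ℕ → ℤ} (hr : r k ≠ 0) (hrec : SatisfiesRecurrence a k r) (hnd : NonDegenerate k r)
    {T : ℕ} (hT : 0 < T) {α : K} {s : Multiset K}
    (hs : ((monicCharPoly k r).map (Int.castRingHom K)).roots = α ::ₘ s) :
    ∃ c ≠ 0, ∀ n, aeval (seqShift K) (s.map fun γ => X ^ T - C (γ ^ T)).prod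
      (fun n => (a n : K)) n = c * α ^ n := by
  have hsplit := monicCharPoly_map_eq_prod K k r
  rw [hs] at hsplit
  have hroot : ∀ x ∈ α ::ₘ s, aeval x (monicCharPoly k r) = 0 := fun x hx =>
    aeval_eq_zero_of_mem_roots_monicCharPoly_map (hs ▸ hx)
  have hα := hroot α (Multiset.mem_cons_self _ _)
  set A : ℕ → K := fun n => (a n : K) with hA
  set w := aeval (seqShift K) (s.map fun γ => X ^ T - C (γ ^ T)).prod A with hw
  have hw1 : aeval (seqShift K) (X - C α) w = 0 := by
    rw [hw, ← Module.End.mul_apply, ← map_mul]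
    refine aeval_seqShift_of_dvd ?_ (aeval_seqShift_monicCharPoly_map hrec)
    rw [hsplit, Multiset.map_cons, Multiset.prod_cons]
    exact mul_dvd_mul_left _ (prod_X_sub_C_dvd_prod_X_pow_sub_C T s)
  have hw2 := eq_mul_pow_of_aeval_X_sub_C hw1
  refine ⟨w 0, fun hw0 => ?_, hw2⟩
  have hdvd := horder.dvd hk hr hrec (show w = 0 by
    funext n
    rw [hw2, hw0, zero_mul, Pi.zero_apply])
  rw [hsplit] at hdvd
  refine not_prod_X_sub_C_dvd hT (ne_zero_of_aeval_monicCharPoly hk.le hr hα) s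
    (fun γ hγ hne => ?_) hdvd
  exact hnd.pow_ne_pow' hk.le hr (hroot γ (Multiset.mem_cons_of_mem hγ)) hα hne hT

/-! ### Approximation by p-adic geometric sequences -/

/-- Some power of a nonzero algebraic `p`-adic number has the norm of a `p`-adic number. -/
lemma exists_norm_pow_eq_norm_padic {p : ℕ} [Fact p.Prime] (x : PadicAlgCl p) :
    ∃ e : ℕ, 0 < e ∧ ∃ c : ℚ_[p], ‖x‖ ^ e = ‖c‖ := by
  -- The exponent is the degree of the minimal polynomial: the spectral norm of `x` is the root of
  -- that order of the norm of the constant coefficient.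
  have hpos := minpoly.natDegree_pos (Algebra.IsIntegral.isIntegral (R := ℚ_[p]) x)
  refine ⟨_, hpos, (minpoly ℚ_[p] x).coeff 0, ?_⟩
  rw [← PadicAlgCl.spectralNorm_eq, spectralNorm.spectralNorm_eq_norm_coeff_zero_rpow, one_div,
    Real.rpow_inv_natCast_pow (norm_nonneg _) hpos.ne']

/-- A bounded recurrence over a proper field is eventually periodic up to `ε`. -/
lemma exists_almost_period {K L : Type*} [NormedField K] [ProperSpace K] [NormedField L]
    [IsUltrametricDist L] [NormedAlgebra K L] (s : Multiset L) (hs : ∀ β ∈ s, ‖β‖ ≤ 1)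
    (u : ℕ → K) (hu : aeval (seqShift L) (s.map fun β => X - C β).prod
      (fun n => algebraMap K L (u n)) = 0) {ε : ℝ} (hε : 0 < ε) :
    ∃ P, 0 < P ∧ ∃ N, ∀ m, N ≤ m → ‖u (m + P) - u m‖ ≤ ε := by
  set B := ∑ i ∈ Finset.range (Multiset.card s), ‖u i‖
  have hB : ∀ n, ‖u n‖ ≤ B := by
    intro n
    have := norm_le_of_aeval_prod_eq_zero s hs _ B (Finset.sum_nonneg fun _ _ => norm_nonneg _) hu
      (fun i hi => by
        rw [norm_algebraMap']
        exact Finset.single_le_sum (f := fun i => ‖u i‖) (fun _ _ => norm_nonneg _)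
          (Finset.mem_range.2 hi)) n
    rwa [norm_algebraMap'] at this
  have hB0 : 0 ≤ B := (norm_nonneg _).trans (hB 0)
  -- The state vectors lie in a bounded set of a proper space, so two of them are `ε`-close. The
  -- difference of the corresponding shifts obeys the same relation and hence stays `ε`-small.
  let x : ℕ → (Fin (Multiset.card s) → K) := fun n i => u (n + i)
  obtain ⟨y, -, φ, hφ, hlim⟩ := tendsto_subseq_of_bounded (x := x)
    (Metric.isBounded_closedBall (x := 0) (r := B)) (fun n => by
      rw [mem_closedBall_zero_iff, pi_norm_le_iff_of_nonneg hB0]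
      exact fun i => hB _)
  obtain ⟨M, hM⟩ := Metric.cauchySeq_iff'.1 hlim.cauchySeq ε hε
  have hlt : φ M < φ (M + 1) := hφ (Nat.lt_succ_self M)
  have hd := hM (M + 1) (Nat.le_succ M)
  refine ⟨φ (M + 1) - φ M, by omega, φ M, fun m hm => ?_⟩
  set N := φ M
  set P := φ (M + 1) - N
  have hNP : φ (M + 1) = N + P := by omega
  set v : ℕ → L := fun n => algebraMap K L (u n)
  have hz := norm_le_of_aeval_prod_eq_zero s hs
    ((fun n => v (N + P + n)) - fun n => v (N + n)) ε hε.le (by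
      funext n
      rw [map_sub, Pi.sub_apply, aeval_seqShift_comp_add, aeval_seqShift_comp_add, hu]
      simp)
    (fun i hi => by
      have := (norm_le_pi_norm (x (φ (M + 1)) - x N) ⟨i, hi⟩).trans
        ((dist_eq_norm _ _).symm.le.trans hd.le)
      rw [Pi.sub_apply, ← map_sub, norm_algebraMap', ← hNP]
      exact this) (m - N)
  rw [Pi.sub_apply, ← map_sub, norm_algebraMap', show N + P + (m - N) = m + P by omega,
    show N + (m - N) = m by omega] at hz
  exact hz

/-- `b` agrees with a geometric sequence up to a `p`-adic relative error less than one. -/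
def PadicGeometric (p : ℕ) [Fact p.Prime] (b : ℕ → ℤ) : Prop :=
  ∃ d c : ℚ_[p], d ≠ 0 ∧ c ≠ 0 ∧ ∀ s, ‖(b s : ℚ_[p]) - d * c ^ s‖ < ‖d * c ^ s‖

/-- Every progression contains a subprogression along which a non-degenerate recurrence sequence
is approximately geometric `p`-adically. -/
lemma exists_padicGeometric_subprogression {a : ℕ → ℤ} {k : ℕ} (hk : 1 < k)
    (horder : HasRecurrenceOrder a k)
    {r : ℕ → ℤ} (hr : r k ≠ 0) (hrec : SatisfiesRecurrence a k r) (hnd : NonDegenerate k r)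
    (p : ℕ) [Fact p.Prime] (N : ℕ) {R : ℕ} (hR : 0 < R) :
    ∃ m t, 0 < t ∧ PadicGeometric p (fun s => a (N + R * (m + t * s))) := by
  classical
  have : IsAlgClosed (PadicAlgCl p) :=
    inferInstanceAs (IsAlgClosed (AlgebraicClosure ℚ_[p]))
  set F := (monicCharPoly k r).map (Int.castRingHom (PadicAlgCl p)) with hF
  have hsplit : F = (F.roots.map fun γ => X - C γ).prod := monicCharPoly_map_eq_prod (PadicAlgCl p) k r
  have hcard : 0 < Multiset.card F.roots := by
    rw [card_roots_monicCharPoly_map]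
    omega
  obtain ⟨α, hα, hmax⟩ := F.roots.toFinset.exists_max_image (fun x => ‖x‖) (by
    obtain ⟨x, hx⟩ := Multiset.card_pos_iff_exists_mem.1 hcard
    exact ⟨x, Multiset.mem_toFinset.2 hx⟩)
  simp only [Multiset.mem_toFinset] at hα hmax
  obtain ⟨s, hs⟩ := Multiset.exists_cons_of_mem hα
  have hα0 : α ≠ 0 := ne_zero_of_aeval_monicCharPoly hk.le hr
    (aeval_eq_zero_of_mem_roots_monicCharPoly_map hα)
  obtain ⟨e, he, c₀, hc₀⟩ := exists_norm_pow_eq_norm_padic α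
  -- The factor `R` keeps the indices in the given progression; the factor `e` puts the norm of
  -- `α^T` into the value group of `ℚ_[p]`.
  set T := R * e with hT
  have hTpos : 0 < T := Nat.mul_pos hR he
  set c := c₀ ^ R with hc
  have hcα : ‖c‖ = ‖α‖ ^ T := by rw [hc, norm_pow, ← hc₀, ← pow_mul, hT, mul_comm]
  have hcpos : 0 < ‖c‖ := by rw [hcα]; exact pow_pos (norm_pos_iff.2 hα0) _
  have hc0 : c ≠ 0 := norm_pos_iff.1 hcpos
  have hcL : algebraMap ℚ_[p] (PadicAlgCl p) c ≠ 0 := by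
    rwa [ne_eq, FaithfulSMul.algebraMap_eq_zero_iff]
  set A : ℕ → (PadicAlgCl p) := fun n => (a n : (PadicAlgCl p)) with hA
  set u : ℕ → ℚ_[p] := fun m => (a (N + T * m) : ℚ_[p]) / c ^ m with hu
  have huL : (fun m => algebraMap ℚ_[p] (PadicAlgCl p) (u m)) =
      fun m => A (N + T * m) / (algebraMap ℚ_[p] (PadicAlgCl p) c) ^ m := by
    funext m
    simp [u, A]
  have hFA : aeval (seqShift (PadicAlgCl p)) F A = 0 := aeval_seqShift_monicCharPoly_map hrec
  have hkill : aeval (seqShift (PadicAlgCl p)) (((F.roots.map fun γ => γ ^ T / algebraMap ℚ_[p] (PadicAlgCl p) c)).map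
      fun β => X - C β).prod (fun m => algebraMap ℚ_[p] (PadicAlgCl p) (u m)) = 0 := by
    funext m
    have := aeval_seqShift_progression N T hcL (F.roots.map (· ^ T)) A m
    rw [Multiset.map_map, Multiset.map_map] at this
    rw [huL, Multiset.map_map]
    refine this.trans ?_
    have h0 := aeval_seqShift_of_dvd (prod_X_sub_C_dvd_prod_X_pow_sub_C T F.roots)
      (a := A) (by rw [← hsplit]; exact hFA)
    simp only [Function.comp_def]
    rw [h0]
    simp
  have hbound : ∀ β ∈ F.roots.map (fun γ => γ ^ T / algebraMap ℚ_[p] (PadicAlgCl p) c), ‖β‖ ≤ 1 := by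
    intro β hβ
    obtain ⟨γ, hγ, rfl⟩ := Multiset.mem_map.1 hβ
    rw [norm_div, norm_algebraMap', norm_pow, hcα]
    refine div_le_one_of_le₀ ?_ (by positivity)
    exact pow_le_pow_left₀ (norm_nonneg _) (hmax γ hγ) _
  have hlim : ¬ Filter.Tendsto u Filter.atTop (nhds 0) := by
    intro hlim
    have hlimL : Filter.Tendsto (fun m => algebraMap ℚ_[p] (PadicAlgCl p) (u m)) Filter.atTop (nhds 0) := by
      rw [tendsto_zero_iff_norm_tendsto_zero] at hlim ⊢
      exact hlim.congr fun m => (norm_algebraMap' (PadicAlgCl p) (u m)).symm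
    obtain ⟨w₀, hw₀, hw⟩ := hnd.isolate_root hk horder hr hrec hTpos hs
    set Q := ((s.map (· ^ T)).map fun γ => X - C (γ / algebraMap ℚ_[p] (PadicAlgCl p) c)).prod
    have hprog : ∀ m, aeval (seqShift (PadicAlgCl p)) Q (fun m => algebraMap ℚ_[p] (PadicAlgCl p) (u m)) m =
        w₀ * α ^ (N + T * m) / (algebraMap ℚ_[p] (PadicAlgCl p) c) ^ (m + Multiset.card s) := by
      intro m
      have := aeval_seqShift_progression N T hcL (s.map (· ^ T)) A m
      rw [Multiset.card_map, Multiset.map_map (fun γ => X ^ T - C γ)] at this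
      rw [huL, ← hw]
      exact this
    have hlimQ : Filter.Tendsto
        (fun m => aeval (seqShift (PadicAlgCl p)) Q (fun m => algebraMap ℚ_[p] (PadicAlgCl p) (u m)) m)
        Filter.atTop (nhds 0) := by
      simp only [aeval_seqShift_apply]
      rw [show (0 : (PadicAlgCl p)) = ∑ i ∈ Finset.range (Q.natDegree + 1), Q.coeff i * 0 by simp]
      refine tendsto_finsetSum _ fun i _ => Filter.Tendsto.const_mul _ ?_
      exact hlimL.comp (Filter.tendsto_add_atTop_nat i)
    -- The isolated term `w₀ * α^(N + T*m)` grows exactly like the normalisation, because `‖α‖^T =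
    -- ‖c‖`.
    have hconst : ∀ m, ‖aeval (seqShift (PadicAlgCl p)) Q (fun m => algebraMap ℚ_[p] (PadicAlgCl p) (u m)) m‖ =
        ‖w₀‖ * ‖α‖ ^ N / ‖c‖ ^ Multiset.card s := by
      intro m
      rw [hprog, norm_div, norm_mul, norm_pow, norm_pow, norm_algebraMap', pow_add, pow_add,
        pow_mul, ← hcα]
      field_simp
    have hz := tendsto_zero_iff_norm_tendsto_zero.1 hlimQ
    simp only [hconst] at hz
    have hz0 := tendsto_nhds_unique hz tendsto_const_nhds
    have hne : ‖w₀‖ * ‖α‖ ^ N / ‖c‖ ^ Multiset.card s ≠ 0 :=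
      div_ne_zero (mul_ne_zero (norm_ne_zero_iff.2 hw₀) (pow_ne_zero _ (norm_ne_zero_iff.2 hα0)))
        (pow_ne_zero _ hcpos.ne')
    exact hne hz0.symm
  rw [Metric.tendsto_atTop] at hlim
  push Not at hlim
  obtain ⟨ε, hε, hfreq⟩ := hlim
  obtain ⟨P, hP, N₀, hper⟩ := exists_almost_period _ hbound u hkill (half_pos hε)
  obtain ⟨m, hm, hum⟩ := hfreq N₀
  rw [dist_zero_right] at hum
  -- By the ultrametric inequality the errors of successive almost periods do not accumulate. Half
  -- of `ε` makes the final relative error strictly less than one.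
  have hclose : ∀ t, ‖u (m + P * t) - u m‖ ≤ ε / 2 := by
    intro t
    induction t with
    | zero => simpa using (half_pos hε).le
    | succ t ih =>
      rw [show u (m + P * (t + 1)) - u m =
        (u (m + P * t + P) - u (m + P * t)) + (u (m + P * t) - u m) by
          rw [mul_add, mul_one, add_assoc]; ring]
      exact (IsUltrametricDist.norm_add_le_max _ _).trans
        (max_le (hper _ (hm.trans (Nat.le_add_right _ _))) ih)
  refine ⟨e * m, e * P, Nat.mul_pos he hP, u m * c ^ m, c ^ P, ?_, pow_ne_zero _ hc0, fun t => ?_⟩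
  · exact mul_ne_zero (norm_pos_iff.1 (hε.trans_le hum)) (pow_ne_zero _ hc0)
  · have h1 : (a (N + R * (e * m + e * P * t)) : ℚ_[p]) = u (m + P * t) * c ^ (m + P * t) := by
      rw [hu]
      simp only
      rw [div_mul_cancel₀ _ (pow_ne_zero _ hc0)]
      congr 3
      rw [hT]; ring
    have h2 : u m * c ^ m * (c ^ P) ^ t = u m * c ^ (m + P * t) := by
      rw [pow_add, pow_mul, mul_assoc]
    rw [h1, h2, ← sub_mul, norm_mul, norm_mul]
    refine mul_lt_mul_of_pos_right ?_ (norm_pos_iff.2 (pow_ne_zero _ hc0))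
    linarith [hclose t]

/-! ### From local approximation to an exact geometric progression -/

lemma PadicGeometric.subprogression {p : ℕ} [Fact p.Prime] {b : ℕ → ℤ} (h : PadicGeometric p b)
    (m t : ℕ) : PadicGeometric p (fun s => b (m + t * s)) := by
  obtain ⟨d, c, hd, hc, h⟩ := h
  refine ⟨d * c ^ m, c ^ t, mul_ne_zero hd (pow_ne_zero _ hc), pow_ne_zero _ hc, fun s => ?_⟩
  rw [show d * c ^ m * (c ^ t) ^ s = d * c ^ (m + t * s) by rw [pow_add, pow_mul, mul_assoc]]
  exact h _

lemma exists_unit_factor {p : ℕ} [Fact p.Prime] {x y : ℚ_[p]} (hy : y ≠ 0)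
    (h : ‖x - y‖ < ‖y‖) : ∃ z, x = y * (1 + z) ∧ ‖z‖ < 1 := by
  refine ⟨(x - y) / y, by field_simp; ring, ?_⟩
  rw [norm_div]
  exact (div_lt_one (norm_pos_iff.2 hy)).2 h

/-- Second-order quotients of an approximately geometric sequence are close to one. -/
lemma PadicGeometric.norm_sub_lt {p : ℕ} [Fact p.Prime] {b : ℕ → ℤ} (h : PadicGeometric p b)
    (s : ℕ) : ‖((b (s + 2) * b s : ℤ) : ℚ_[p]) - ((b (s + 1) ^ 2 : ℤ) : ℚ_[p])‖ <
      ‖((b (s + 1) ^ 2 : ℤ) : ℚ_[p])‖ := by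
  obtain ⟨d, c, hd, hc, h⟩ := h
  have hne : ∀ n, d * c ^ n ≠ 0 := fun n => mul_ne_zero hd (pow_ne_zero _ hc)
  obtain ⟨x, hx, hx1⟩ := exists_unit_factor (hne _) (h (s + 2))
  obtain ⟨y, hy, hy1⟩ := exists_unit_factor (hne _) (h s)
  obtain ⟨z, hz, hz1⟩ := exists_unit_factor (hne _) (h (s + 1))
  have hzn : ‖1 + z‖ = 1 := by
    rw [IsUltrametricDist.norm_add_eq_max_of_norm_ne_norm (by rw [norm_one]; exact hz1.ne'),
      norm_one, max_eq_left hz1.le]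
  have hadd : ∀ v w : ℚ_[p], ‖v‖ < 1 → ‖w‖ < 1 → ‖v + w‖ < 1 := fun v w hv hw =>
    (IsUltrametricDist.norm_add_le_max _ _).trans_lt (max_lt hv hw)
  have hmul : ∀ v w : ℚ_[p], ‖v‖ < 1 → ‖w‖ < 1 → ‖v * w‖ < 1 := fun v w hv hw => by
    rw [norm_mul]; exact mul_lt_one_of_nonneg_of_lt_one_left (norm_nonneg _) hv hw.le
  have hneg : ∀ v : ℚ_[p], ‖v‖ < 1 → ‖-v‖ < 1 := fun v hv => by rwa [norm_neg]
  push_cast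
  rw [hx, hy, hz, show d * c ^ (s + 2) * (1 + x) * (d * c ^ s * (1 + y)) -
      (d * c ^ (s + 1) * (1 + z)) ^ 2 =
      (d * c ^ (s + 1)) ^ 2 * (((x + y) + x * y) + (-(z + z) + -(z * z))) by ring,
    mul_pow _ (1 + z), norm_mul, norm_mul, norm_pow (1 + z), hzn, one_pow, mul_one]
  refine mul_lt_of_lt_one_right (norm_pos_iff.2 (pow_ne_zero _ (hne _))) ?_
  exact hadd _ _ (hadd _ _ (hadd _ _ hx1 hy1) (hmul _ _ hx1 hy1))
    (hadd _ _ (hneg _ (hadd _ _ hz1 hz1)) (hneg _ (hmul _ _ hz1 hz1)))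

lemma PadicGeometric.norm_eq {p : ℕ} [Fact p.Prime] {b : ℕ → ℤ} (h : PadicGeometric p b)
    (s : ℕ) : ‖((b (s + 2) * b s : ℤ) : ℚ_[p])‖ = ‖((b (s + 1) ^ 2 : ℤ) : ℚ_[p])‖ := by
  have h1 := h.norm_sub_lt s
  rw [sub_eq_add_neg] at h1
  rw [← norm_neg ((b (s + 1) ^ 2 : ℤ) : ℚ_[p])]
  apply IsUltrametricDist.norm_eq_of_add_norm_lt_max
  rw [norm_neg]
  exact h1.trans_le (le_max_right _ _)

/-- Integers with the same `p`-adic norms for all `p` agree up to sign. -/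
lemma natAbs_eq_of_forall_padic_norm_eq {x y : ℤ}
    (h : ∀ (p : ℕ) [Fact p.Prime], ‖(x : ℚ_[p])‖ = ‖(y : ℚ_[p])‖) : x.natAbs = y.natAbs := by
  have key : ∀ p n : ℕ, p.Prime → (p ^ n ∣ x.natAbs ↔ p ^ n ∣ y.natAbs) := by
    intro p n hp
    have : Fact p.Prime := ⟨hp⟩
    rw [← Int.natCast_dvd, ← Int.natCast_dvd, Nat.cast_pow, ← Padic.norm_int_le_pow_iff_dvd,
      ← Padic.norm_int_le_pow_iff_dvd, h p]
  apply Nat.dvd_antisymm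
  · exact (Nat.dvd_iff_prime_pow_dvd_dvd _ _).2 fun p n hp => (key p n hp).1
  · exact (Nat.dvd_iff_prime_pow_dvd_dvd _ _).2 fun p n hp => (key p n hp).2

/-- Simultaneous version of `exists_padicGeometric_subprogression`. -/
lemma exists_forall_padicGeometric {a : ℕ → ℤ} {k : ℕ} (hk : 1 < k)
    (horder : HasRecurrenceOrder a k)
    {r : ℕ → ℤ} (hr : r k ≠ 0) (hrec : SatisfiesRecurrence a k r) (hnd : NonDegenerate k r)
    (S : Finset ℕ) : ∃ N T, 0 < T ∧ ∀ (p : ℕ) [Fact p.Prime], p ∈ S →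
      PadicGeometric p (fun s => a (N + T * s)) := by
  classical
  induction S using Finset.induction_on with
  | empty => exact ⟨0, 1, one_pos, by simp⟩
  | insert q S _ ih =>
    obtain ⟨N, T, hT, h⟩ := ih
    by_cases hq : q.Prime
    · have : Fact q.Prime := ⟨hq⟩
      obtain ⟨m, t, ht, hmt⟩ :=
        exists_padicGeometric_subprogression hk horder hr hrec hnd q N hT
      refine ⟨N + T * m, T * t, Nat.mul_pos hT ht, fun p _ hp => ?_⟩
      simp only [show ∀ s, N + T * m + T * t * s = N + T * (m + t * s) by intro s; ring]
      rcases Finset.mem_insert.1 hp with rfl | hp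
      · exact hmt
      · exact (h p hp).subprogression m t
    · refine ⟨N, T, hT, fun p hpr hp => h p ?_⟩
      exact (Finset.mem_insert.1 hp).resolve_left fun hpq => hq (hpq ▸ hpr.out)

/-- A non-degenerate recurrence sequence of order at least two is not geometric along any
progression. -/
lemma NonDegenerate.not_geometric {a : ℕ → ℤ} {k : ℕ} (hk : 1 < k)
    (horder : HasRecurrenceOrder a k)
    {r : ℕ → ℤ} (hr : r k ≠ 0) (hrec : SatisfiesRecurrence a k r) (hnd : NonDegenerate k r)
    (N : ℕ) {T : ℕ} (hT : 0 < T) (d D : ℂ) :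
    ¬ ∀ m, (a (N + T * m) : ℂ) = d * D ^ m := by
  intro h
  -- Along a geometric progression, the operator isolating `α` multiplies by `Q.eval D`. Comparing
  -- `m = 0` and `m = 1` forces `α^T = D`, and `Q.eval D ≠ 0` keeps `γ^T` away from `D` for every
  -- other listed root.
  have key : ∀ α s, ((monicCharPoly k r).map (Int.castRingHom ℂ)).roots = α ::ₘ s →
      α ^ T = D ∧ ∀ γ ∈ s, γ ^ T ≠ D := by
    intro α s hs
    obtain ⟨c, hc, hw⟩ := hnd.isolate_root hk horder hr hrec hT hs
    have hα := ne_zero_of_aeval_monicCharPoly hk.le hr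
      (aeval_eq_zero_of_mem_roots_monicCharPoly_map
        (show α ∈ _ from hs ▸ Multiset.mem_cons_self _ _))
    set Q : ℂ[X] := ((s.map (· ^ T)).map fun γ => X - C (γ / 1)).prod with hQ
    have hprog : ∀ m, Q.eval D * (d * D ^ m) = c * α ^ (N + T * m) := by
      intro m
      have h1 := aeval_seqShift_progression N T one_ne_zero (s.map (· ^ T))
        (fun n => (a n : ℂ)) m
      rw [one_pow, div_one, Multiset.map_map (fun γ => X ^ T - C γ), ← hQ] at h1
      rw [← hw]
      refine Eq.trans ?_ h1
      simp only [aeval_seqShift_apply, h, one_pow, div_one]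
      rw [eval_eq_sum_range, Finset.sum_mul]
      exact Finset.sum_congr rfl fun i _ => by rw [pow_add]; ring
    have h0 := hprog 0
    have h1 := hprog 1
    simp only [mul_zero, add_zero, pow_zero, mul_one, pow_one, pow_add] at h0 h1
    have hne : c * α ^ N ≠ 0 := mul_ne_zero hc (pow_ne_zero _ hα)
    constructor
    · apply mul_left_cancel₀ hne
      rw [mul_assoc, ← h1, ← h0]
      ring
    · rintro γ hγ rfl
      have hQ0 : Q.eval (γ ^ T) = 0 := by
        rw [hQ, eval_multiset_prod]
        refine Multiset.prod_eq_zero (Multiset.mem_map.2 ⟨X - C (γ ^ T / 1), ?_, by simp⟩)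
        exact Multiset.mem_map_of_mem _ (Multiset.mem_map_of_mem _ hγ)
      rw [hQ0, zero_mul] at h0
      exact hne h0.symm
  have hcard := card_roots_monicCharPoly_map ℂ k r
  obtain ⟨α, hα⟩ := Multiset.card_pos_iff_exists_mem.1 (by omega :
    0 < Multiset.card ((monicCharPoly k r).map (Int.castRingHom ℂ)).roots)
  obtain ⟨s, hs⟩ := Multiset.exists_cons_of_mem hα
  rw [hs, Multiset.card_cons] at hcard
  obtain ⟨γ, hγ⟩ := Multiset.card_pos_iff_exists_mem.1 (by omega : 0 < Multiset.card s)
  obtain ⟨t, rfl⟩ := Multiset.exists_cons_of_mem hγ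
  -- Isolating `γ` instead of `α` gives `γ^T = D`, a contradiction; two listed roots exist because
  -- `1 < k`.
  exact (key α _ hs).2 γ hγ (key γ (α ::ₘ t) (by rw [hs, Multiset.cons_swap])).1

theorem theorem3p4 (a : ℕ → ℤ) (k : ℕ) (hk : 1 < k) (horder : HasRecurrenceOrder a k)
    (r : ℕ → ℤ) (hr : r k ≠ 0) (hrec : SatisfiesRecurrence a k r)
    (hnd : NonDegenerate k r) :
    (primeDivisors a).Infinite := by
  intro hfin
  -- The prime `q` serves twice: dividing no term, it shows that the terms are nonzero; being odd,
  -- it later decides a sign.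
  obtain ⟨q, hqS, hq⟩ := (Nat.infinite_setOfPred_prime.sdiff
    (hfin.union (Set.finite_singleton 2))).nonempty.imp fun q hq => And.intro hq.2 hq.1
  have hqp : q.Prime := hq
  have hq2 : q ≠ 2 := fun h => hqS (Or.inr h)
  obtain ⟨N, T, hT, hgeom⟩ :=
    exists_forall_padicGeometric hk horder hr hrec hnd (insert q hfin.toFinset)
  set b : ℕ → ℤ := fun s => a (N + T * s) with hb
  have hunit : ∀ (p : ℕ) [Fact p.Prime], p ∉ primeDivisors a → ∀ s, ‖(b s : ℚ_[p])‖ = 1 := by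
    intro p hp hpa s
    refine le_antisymm (Padic.norm_int_le_one _) (not_lt.1 fun hlt => hpa ⟨hp.out, N + T * s, ?_⟩)
    exact (Padic.norm_intCast_lt_one_iff).1 hlt
  have hb0 : ∀ s, b s ≠ 0 := by
    intro s h0
    have : Fact q.Prime := ⟨hqp⟩
    have := hunit q (fun h => hqS (Or.inl h)) s
    simp [h0] at this
  have habs : ∀ s, (b (s + 2) * b s).natAbs = (b (s + 1) ^ 2).natAbs := by
    intro s
    refine natAbs_eq_of_forall_padic_norm_eq fun p _ => ?_
    by_cases hp : p ∈ primeDivisors a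
    · exact (hgeom p (Finset.mem_insert_of_mem (hfin.mem_toFinset.2 hp))).norm_eq s
    · push_cast
      rw [norm_mul, norm_pow, hunit p hp, hunit p hp, hunit p hp]
      norm_num
  have hsq : ∀ s, b (s + 2) * b s = b (s + 1) ^ 2 := by
    intro s
    refine (Int.natAbs_eq_natAbs_iff.1 (habs s)).resolve_right fun hneg => ?_
    have : Fact q.Prime := ⟨hqp⟩
    have h1 := (hgeom q (Finset.mem_insert_self _ _)).norm_sub_lt s
    change ‖((b (s + 2) * b s : ℤ) : ℚ_[q]) - ((b (s + 1) ^ 2 : ℤ) : ℚ_[q])‖ <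
      ‖((b (s + 1) ^ 2 : ℤ) : ℚ_[q])‖ at h1
    have h2 : ‖(2 : ℚ_[q])‖ = 1 := by
      have : ¬ (q : ℤ) ∣ 2 := fun hd =>
        hq2 ((Nat.prime_dvd_prime_iff_eq hqp Nat.prime_two).1 (by exact_mod_cast hd))
      refine le_antisymm (by exact_mod_cast Padic.norm_int_le_one (p := q) 2)
        (not_lt.1 fun hlt => ?_)
      exact this ((Padic.norm_intCast_lt_one_iff).1 (by exact_mod_cast hlt))
    -- With the minus sign the difference would be `-2 * b (s+1)^2`, whose `q`-adic norm equals that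
    -- of `b (s+1)^2`.
    rw [hneg, Int.cast_neg, show ∀ x : ℚ_[q], -x - x = -(2 * x) by intro x; ring, norm_neg,
      norm_mul, h2, one_mul] at h1
    exact lt_irrefl _ h1
  have hbC : ∀ s, (b s : ℂ) ≠ 0 := fun s => Int.cast_ne_zero.2 (hb0 s)
  have hratio : ∀ s, (b (s + 1) : ℂ) = b s * (b 1 / b 0) := by
    intro s
    induction s with
    | zero => rw [mul_div_cancel₀ _ (hbC 0)]
    | succ s ih =>
      have h1 : (b (s + 2) : ℂ) * b s = b (s + 1) ^ 2 := by exact_mod_cast hsq s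
      apply mul_right_cancel₀ (hbC s)
      rw [h1, sq]
      nth_rewrite 2 [ih]
      ring
  refine hnd.not_geometric hk horder hr hrec N hT (b 0) (b 1 / b 0) fun m => ?_
  change (b m : ℂ) = _
  induction m with
  | zero => simp
  | succ m ih => rw [hratio, ih]; ring
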